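/- Let $d,g\in\mathbb N$ and let $A=(A_1,\dots,A_g)$ be a $g$-tuple of Hermitian $d\times d$ complex matrices. Let $\mathcal W(A)=\{(\langle x,A_1x\rangle,\dots,\langle x,A_gx\rangle): x\in\mathbb C^d,\ \|x\|_2=1\}\subseteq\mathbb R^g$ be the joint numerical range. For $\mathcal C\subseteq\mathbb R^g$ let $\mathcal C_{\min}(n)$ be the set of tuples of the form $\bigl(\sum_j z_j(1)Q_j,\dots,\sum_j z_j(g)Q_j\bigr)$, where $(Q_j)_j$ is a finite family of positive semidefinite $n\times n$ matrices with $\sum_jQ_j=I_n$ and $z_j\in\mathcal C$ for all $j$. Let $\operatorname{MR}(A)_n=\{(\Phi(A_1),\dots,\Phi(A_g)):\Phi:\mathcal M_d(\mathbb C)\to\mathcal M_n(\mathbb C)\text{ unital completely positive}\}$ be the matrix range. Equalities and inclusions between such families of sets are meant for every $n$. A polytope $P\subseteq\mathbb R^g$ here is the convex hull of finitely many points and satisfies $0\in\operatorname{int}P$; let $v_1,\dots,v_k$ be its extreme points. The tuple $A$ consists of $P$-operators if $\sum_i h_i\operatorname{Tr}[A_i\rho]\le 1$ for every density matrix $\rho$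 and every $h\in\mathbb R^g$ with $\langle h,x\rangle\le1$ for all $x\in P$. It is $P$-compatible if there are positive semidefinite $d\times d$ matrices $C_1,\dots,C_k$ with $\sum_jC_j=I_d$ and $A_i=\sum_{j} v_j(i)\,C_j$ for all $i$. Consider the condition (S) There are a unitary $U$, a tuple $B=(B_1,\dots,B_g)$ of pairwise commuting normal $m\times m$ matrices and a tuple $E=(E_1,\dots,E_g)$ of $e\times e$ matrices, with $m+e=d$ (size $0$ is allowed, meaning that the summand is absent), such that $A_i=U(B_i\oplus E_i)U^*$ for all $i$, $\operatorname{conv}\sigma(B)=\operatorname{conv}\mathcal W(A)$, where $\sigma(B)$ is the joint spectrum of $B$, that is, the set of tuples of joint eigenvalues, and $\operatorname{MR}(E)\subseteq(\operatorname{conv}\mathcal W(A))_{\min}$. Then: 1. If $0\in\operatorname{int}(\operatorname{conv}\mathcal W(A))$, then $A$ is $P$-compatible for all polytopes $P$ for which it consists of $P$-operators if and only if (S) holds. 2. Without any assumption on $0$, $\operatorname{MR}(A)=(\operatorname{conv}\mathcal W(A))_{\min}$ if and only if (S) holds. -/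

import Mathlib

open scoped ComplexOrder Matrix

/-- The joint numerical range `𝒲(A) ⊆ ℝ^g` of a `g`-tuple of matrices: the points
`(⟨x, A₁ x⟩, …, ⟨x, A_g x⟩)` for unit vectors `x ∈ ℂ^d` (real numbers when the `A i` are
Hermitian). -/
def jointNumericalRange {g d : ℕ} (A : Fin g → Matrix (Fin d) (Fin d) ℂ) : Set (Fin g → ℝ) :=
  {p | ∃ x : EuclideanSpace ℂ (Fin d), ‖x‖ = 1 ∧
    ∀ i, ((p i : ℝ) : ℂ) = star (x.ofLp) ⬝ᵥ (A i *ᵥ x.ofLp)}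

/-- `P ⊆ ℝ^g` is a polytope whose pairwise distinct extreme points are `v 0, …, v (k - 1)`. -/
structure IsPolytopeWithVertices {g k : ℕ} (P : Set (Fin g → ℝ)) (v : Fin k → Fin g → ℝ) :
    Prop where
  injective : Function.Injective v
  range_eq_extremePoints : Set.range v = P.extremePoints ℝ
  eq_convexHull : P = convexHull ℝ (Set.range v)

/-- The polar dual `P° = {h | ⟨h, x⟩ ≤ 1 for all x ∈ P}`. -/
def polarDual {g : ℕ} (P : Set (Fin g → ℝ)) : Set (Fin g → ℝ) :=
  {h | ∀ x ∈ P, h ⬝ᵥ x ≤ 1}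

/-- Density matrices: positive semidefinite with trace one. -/
def IsDensityMatrix {d : ℕ} (ρ : Matrix (Fin d) (Fin d) ℂ) : Prop :=
  ρ.PosSemidef ∧ ρ.trace = 1

/-- A POVM: positive semidefinite matrices that sum to the identity. -/
def IsPOVM {d k : ℕ} (C : Fin k → Matrix (Fin d) (Fin d) ℂ) : Prop :=
  (∀ j, (C j).PosSemidef) ∧ ∑ j, C j = 1

/-- `A` are `P`-operators: `⟨A, h ⊗ ρ⟩ = ∑ i, h i * Tr[A i ρ] ≤ 1` for every `h ∈ P°` and every
density matrix `ρ`. -/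
def IsPolytopeOperators {g d : ℕ} (P : Set (Fin g → ℝ))
    (A : Fin g → Matrix (Fin d) (Fin d) ℂ) : Prop :=
  ∀ h ∈ polarDual P, ∀ ρ : Matrix (Fin d) (Fin d) ℂ, IsDensityMatrix ρ →
    ∑ i, h i * ((A i * ρ).trace).re ≤ 1

/-- `A` are `P`-compatible, for the polytope `P` with extreme points `v 0, …, v (k - 1)`:
`A = ∑ j, v j ⊗ C j` for some POVM `C`. -/
def IsPolytopeCompatible {g d k : ℕ} (v : Fin k → Fin g → ℝ)
    (A : Fin g → Matrix (Fin d) (Fin d) ℂ) : Prop :=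
  ∃ C : Fin k → Matrix (Fin d) (Fin d) ℂ, IsPOVM C ∧
    ∀ i, A i = ∑ j, ((v j i : ℝ) : ℂ) • C j

/-- Level `n` of the minimal matrix convex set of `K ⊆ ℝ^g`: the tuples `∑ j, z j ⊗ Q j` with
`z j ∈ K` and `Q` a (finite) POVM. Such tuples automatically consist of Hermitian matrices. -/
def minMatrixConvexSet {g : ℕ} (K : Set (Fin g → ℝ)) (n : ℕ) :
    Set (Fin g → Matrix (Fin n) (Fin n) ℂ) :=
  {X | ∃ (k : ℕ) (z : Fin k → Fin g → ℝ) (Q : Fin k → Matrix (Fin n) (Fin n) ℂ),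
    (∀ j, z j ∈ K) ∧ IsPOVM Q ∧ ∀ i, X i = ∑ j, ((z j i : ℝ) : ℂ) • Q j}

/-- Unital completely positive maps `M_d(ℂ) → M_n(ℂ)`: `Φ 1 = 1`, and for every `k` the
entrywise application of `Φ` to `k × k` block matrices preserves positive semidefiniteness
(`Matrix.comp` regards a block matrix as a matrix with scalar entries). -/
structure IsUCP {d n : ℕ} (Φ : Matrix (Fin d) (Fin d) ℂ →ₗ[ℂ] Matrix (Fin n) (Fin n) ℂ) :
    Prop where
  map_one : Φ 1 = 1
  completelyPositive : ∀ (k : ℕ) (M : Matrix (Fin k) (Fin k) (Matrix (Fin d) (Fin d) ℂ)),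
    (Matrix.comp (Fin k) (Fin k) (Fin d) (Fin d) ℂ M).PosSemidef →
      (Matrix.comp (Fin k) (Fin k) (Fin n) (Fin n) ℂ (M.map Φ)).PosSemidef

/-- Level `n` of the matrix range `MR(A)`: the images of `A` under all UCP maps into `M_n(ℂ)`. -/
def matrixRange {g d : ℕ} (A : Fin g → Matrix (Fin d) (Fin d) ℂ) (n : ℕ) :
    Set (Fin g → Matrix (Fin n) (Fin n) ℂ) :=
  {X | ∃ Φ : Matrix (Fin d) (Fin d) ℂ →ₗ[ℂ] Matrix (Fin n) (Fin n) ℂ, IsUCP Φ ∧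
    ∀ i, X i = Φ (A i)}

/-- The joint spectrum `σ(B) ⊆ ℂ^g` of a tuple of pairwise commuting normal matrices: the tuples
of eigenvalues that belong to a common eigenvector. -/
def jointSpectrum {g m : ℕ} (B : Fin g → Matrix (Fin m) (Fin m) ℂ) : Set (Fin g → ℂ) :=
  {l | ∃ x : Fin m → ℂ, x ≠ 0 ∧ ∀ i, B i *ᵥ x = l i • x}

/-- The inclusion `ℝ^g ⊆ ℂ^g`. -/
def realToComplex {g : ℕ} (p : Fin g → ℝ) : Fin g → ℂ := fun i => ((p i : ℝ) : ℂ)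

/-- `A` is unitarily equivalent to the direct sum `B ⊕ E`: `A i = U (B i ⊕ E i) U*` for one
unitary `U : ℂ^m ⊕ ℂ^e → ℂ^d`. Each summand may have size zero. -/
def IsUnitarilyEquivalentToSum {g d m e : ℕ} (A : Fin g → Matrix (Fin d) (Fin d) ℂ)
    (B : Fin g → Matrix (Fin m) (Fin m) ℂ) (E : Fin g → Matrix (Fin e) (Fin e) ℂ) : Prop :=
  ∃ U : Matrix (Fin d) (Fin m ⊕ Fin e) ℂ, Uᴴ * U = 1 ∧ U * Uᴴ = 1 ∧
    ∀ i, A i = U * Matrix.fromBlocks (B i) 0 0 (E i) * Uᴴ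

/-- `A` is unitarily equivalent to `B ⊕ E`, where `B` is normal and pairwise commuting with
`conv σ(B) = conv 𝒲(A)`, and `MR(E) ⊆ (conv 𝒲(A))_min`. -/
def HasDeterminingCommutingPart {g d : ℕ} (A : Fin g → Matrix (Fin d) (Fin d) ℂ) : Prop :=
  ∃ (m e : ℕ) (B : Fin g → Matrix (Fin m) (Fin m) ℂ) (E : Fin g → Matrix (Fin e) (Fin e) ℂ),
    IsUnitarilyEquivalentToSum A B E ∧
    (∀ i, IsStarNormal (B i)) ∧
    (∀ i j, Commute (B i) (B j)) ∧
    convexHull ℝ (jointSpectrum B) = realToComplex '' convexHull ℝ (jointNumericalRange A) ∧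
    ∀ n : ℕ, matrixRange E n ⊆ minMatrixConvexSet (convexHull ℝ (jointNumericalRange A)) n

/-! Put K = conv 𝒲(A). Each condition in the theorem is equivalent to the single membership A ∈
K_min at level d.

For (S), write A = ∑ z_j ⊗ Q_j with z_j ∈ K. Then K = conv {z_j} has finitely many extreme points,
and each extreme point p is attained in 𝒲(A) by a unit vector x. Since p = ∑ ⟨x, Q_j x⟩ z_j,
extremality forces z_j = p whenever Q_j x ≠ 0, so A_i x = p_i x (`mulVec_eq_smul_of_extremePoint`).
These joint eigenvectors are orthonormal and split off a diagonal B with conv σ(B) = K; the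
remaining compression E stays in K_min. Conversely, the spectral POVM of B and a POVM for E combine
into one for A.

For the matrix range, K_min ⊆ MR(A) always holds, through maps Y ↦ ∑ φ_j(Y) Q_j with states φ_j. The
other inclusion says that A ∈ K_min, because UCP maps carry POVMs to POVMs.

For polytopes, A consists of P-operators iff 𝒲(A) ⊆ P, and is P-compatible iff A ∈ P_min. Hence A ∈
K_min gives compatibility by monotonicity. Conversely, a polytope between K and tK with t > 1 gives
t⁻¹A ∈ K_min, and t → 1 suffices because K_min is closed. -/

section RankOne

/-! ### Rank-one projections and spectral decompositions -/

theorem OrthonormalBasis.sum_vecMulVec_star {n ι : Type*} [Fintype n] [DecidableEq n] [Fintype ι]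
    (b : OrthonormalBasis ι ℂ (EuclideanSpace ℂ n)) :
    ∑ l, Matrix.vecMulVec (b l).ofLp (star (b l).ofLp) = 1 := by
  ext i j
  have h := b.sum_inner_mul_inner (EuclideanSpace.single i 1) (EuclideanSpace.single j 1)
  simp only [EuclideanSpace.inner_single_left, EuclideanSpace.inner_single_right, map_one,
    one_mul] at h
  rw [Matrix.sum_apply, Matrix.one_apply]
  simpa [Matrix.vecMulVec_apply, Pi.single_apply, eq_comm] using h

theorem OrthonormalBasis.eq_sum_smul_vecMulVec_star {n ι : Type*} [Fintype n] [DecidableEq n]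
    [Fintype ι] (b : OrthonormalBasis ι ℂ (EuclideanSpace ℂ n)) {M : Matrix n n ℂ} {c : ι → ℂ}
    (h : ∀ l, M *ᵥ (b l).ofLp = c l • (b l).ofLp) :
    M = ∑ l, c l • Matrix.vecMulVec (b l).ofLp (star (b l).ofLp) := by
  conv_lhs => rw [← mul_one M, ← b.sum_vecMulVec_star, Finset.mul_sum]
  refine Finset.sum_congr rfl fun l _ => ?_
  rw [Matrix.mul_vecMulVec, h, Matrix.smul_vecMulVec]

theorem Matrix.PosSemidef.exists_eq_sum_smul_vecMulVec_star {n : Type*} [Fintype n]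
    [DecidableEq n] {Q : Matrix n n ℂ} (hQ : Q.PosSemidef) :
    ∃ (μ : n → ℝ) (u : n → EuclideanSpace ℂ n), (∀ l, 0 ≤ μ l) ∧ (∀ l, ‖u l‖ = 1) ∧
      Q = ∑ l, (μ l : ℂ) • Matrix.vecMulVec (u l).ofLp (star (u l).ofLp) := by
  refine ⟨hQ.1.eigenvalues, hQ.1.eigenvectorBasis, hQ.eigenvalues_nonneg,
    hQ.1.eigenvectorBasis.orthonormal.1, ?_⟩
  refine hQ.1.eigenvectorBasis.eq_sum_smul_vecMulVec_star fun l => ?_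
  rw [hQ.1.mulVec_eigenvectorBasis]
  ext i
  simp

theorem EuclideanSpace.star_dotProduct_self_of_norm_eq_one {n : Type*} [Fintype n]
    {x : EuclideanSpace ℂ n} (hx : ‖x‖ = 1) : star x.ofLp ⬝ᵥ x.ofLp = 1 := by
  have h := inner_self_eq_norm_sq_to_K (𝕜 := ℂ) x
  rw [hx, EuclideanSpace.inner_eq_star_dotProduct, dotProduct_comm] at h
  simpa using h

theorem EuclideanSpace.trace_vecMulVec_star_of_norm_eq_one {n : Type*} [Fintype n]
    {x : EuclideanSpace ℂ n} (hx : ‖x‖ = 1) :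
    (Matrix.vecMulVec x.ofLp (star x.ofLp)).trace = 1 := by
  rw [Matrix.trace_vecMulVec, dotProduct_comm, star_dotProduct_self_of_norm_eq_one hx]

theorem Matrix.trace_mul_vecMulVec_star {n : Type*} [Fintype n] (M : Matrix n n ℂ) (x : n → ℂ) :
    (M * Matrix.vecMulVec x (star x)).trace = star x ⬝ᵥ (M *ᵥ x) := by
  rw [Matrix.mul_vecMulVec, Matrix.trace_vecMulVec, dotProduct_comm]

end RankOne

/-! ### Minimal matrix convex sets -/

section MinimalSet

variable {g d n : ℕ}

theorem mem_minMatrixConvexSet_of_fintype {ι : Type*} [Fintype ι] {K : Set (Fin g → ℝ)}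
    {X : Fin g → Matrix (Fin n) (Fin n) ℂ} (z : ι → Fin g → ℝ) (Q : ι → Matrix (Fin n) (Fin n) ℂ)
    (hz : ∀ j, z j ∈ K) (hQ : ∀ j, (Q j).PosSemidef) (hQ1 : ∑ j, Q j = 1)
    (hX : ∀ i, X i = ∑ j, ((z j i : ℝ) : ℂ) • Q j) : X ∈ minMatrixConvexSet K n := by
  let e := (Fintype.equivFin ι).symm
  refine ⟨Fintype.card ι, z ∘ e, Q ∘ e, fun j => hz _, ⟨fun j => hQ _, ?_⟩, fun i => ?_⟩
  · rw [← hQ1]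
    exact e.sum_comp Q
  · rw [hX i]
    exact (e.sum_comp fun j => ((z j i : ℝ) : ℂ) • Q j).symm

theorem minMatrixConvexSet_mono {K L : Set (Fin g → ℝ)} (h : K ⊆ L) :
    minMatrixConvexSet K n ⊆ minMatrixConvexSet L n := by
  rintro X ⟨k, z, Q, hz, hQ, hX⟩
  exact ⟨k, z, Q, fun j => h (hz j), hQ, hX⟩

/-- Expanding each z_j as a convex combination of the v_l and regrouping by vertex gives the POVM
C_l = ∑ j, w_j(l) Q_j. -/
theorem IsPolytopeCompatible.of_mem_minMatrixConvexSet {k : ℕ} {v : Fin k → Fin g → ℝ}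
    {X : Fin g → Matrix (Fin n) (Fin n) ℂ}
    (hX : X ∈ minMatrixConvexSet (convexHull ℝ (Set.range v)) n) : IsPolytopeCompatible v X := by
  obtain ⟨k', z, Q, hz, hQ, hX⟩ := hX
  have hw : ∀ j, ∃ w : Fin k → ℝ, (∀ l, 0 ≤ w l) ∧ ∑ l, w l = 1 ∧ ∑ l, w l • v l = z j := by
    intro j
    have h := hz j
    rw [convexHull_range_eq_exists_affineCombination] at h
    obtain ⟨s, w, hw0, hw1, h⟩ := h
    rw [s.affineCombination_eq_linear_combination v w hw1] at h
    classical
    refine ⟨fun l => if l ∈ s then w l else 0, fun l => ?_, ?_, ?_⟩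
    · dsimp only
      split_ifs with hl
      exacts [hw0 l hl, le_rfl]
    · simpa using hw1
    · simpa [ite_smul] using h
  choose w hw0 hw1 hwz using hw
  refine ⟨fun l => ∑ j, (w j l : ℂ) • Q j, ⟨fun l => ?_, ?_⟩, fun i => ?_⟩
  · exact Matrix.posSemidef_sum _ fun j _ => (hQ.1 j).smul (by exact_mod_cast hw0 j l)
  · rw [Finset.sum_comm, ← hQ.2]
    refine Finset.sum_congr rfl fun j _ => ?_
    rw [← Finset.sum_smul, ← Complex.ofReal_sum, hw1, Complex.ofReal_one, one_smul]
  · rw [hX i]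
    simp_rw [Finset.smul_sum, smul_smul]
    rw [Finset.sum_comm]
    refine Finset.sum_congr rfl fun j _ => ?_
    rw [← Finset.sum_smul, ← hwz j]
    congr 1
    simp [mul_comm]

theorem IsPolytopeCompatible.mem_minMatrixConvexSet {k : ℕ} {v : Fin k → Fin g → ℝ}
    {X : Fin g → Matrix (Fin n) (Fin n) ℂ} {K : Set (Fin g → ℝ)} (hv : ∀ j, v j ∈ K)
    (hX : IsPolytopeCompatible v X) : X ∈ minMatrixConvexSet K n := by
  obtain ⟨C, hC, hX⟩ := hX
  exact ⟨k, v, C, hv, hC, hX⟩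

end MinimalSet

/-! ### UCP maps and the matrix range -/

section UCP

variable {g d n : ℕ}

theorem IsUCP.map_posSemidef {Φ : Matrix (Fin d) (Fin d) ℂ →ₗ[ℂ] Matrix (Fin n) (Fin n) ℂ}
    (hΦ : IsUCP Φ) {Q : Matrix (Fin d) (Fin d) ℂ} (hQ : Q.PosSemidef) : (Φ Q).PosSemidef := by
  have h := hΦ.completelyPositive 1 (Matrix.of fun _ _ => Q)
    (hQ.submatrix (fun p : Fin 1 × Fin d => p.2))
  exact h.submatrix (fun i : Fin n => ((0 : Fin 1), i))

theorem IsUCP.id : IsUCP (LinearMap.id : Matrix (Fin d) (Fin d) ℂ →ₗ[ℂ] _) where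
  map_one := rfl
  completelyPositive _ _ h := h

theorem mem_matrixRange_self (A : Fin g → Matrix (Fin d) (Fin d) ℂ) : A ∈ matrixRange A d :=
  ⟨LinearMap.id, IsUCP.id, fun _ => rfl⟩

theorem matrixRange_subset_minMatrixConvexSet {K : Set (Fin g → ℝ)}
    {A : Fin g → Matrix (Fin d) (Fin d) ℂ} (hA : A ∈ minMatrixConvexSet K d) (n : ℕ) :
    matrixRange A n ⊆ minMatrixConvexSet K n := by
  rintro X ⟨Φ, hΦ, hX⟩
  obtain ⟨k, z, Q, hz, hQ, hA⟩ := hA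
  refine ⟨k, z, fun j => Φ (Q j), hz, ⟨fun j => hΦ.map_posSemidef (hQ.1 j), ?_⟩, fun i => ?_⟩
  · rw [← map_sum, hQ.2, hΦ.map_one]
  · rw [hX, hA, map_sum]
    simp_rw [map_smul]

/-- The functional `Y ↦ ⟨x, Y x⟩`. -/
def vectorFunctional {n : Type*} [Fintype n] (x : n → ℂ) : Matrix n n ℂ →ₗ[ℂ] ℂ where
  toFun Y := star x ⬝ᵥ (Y *ᵥ x)
  map_add' Y Z := by rw [Matrix.add_mulVec, dotProduct_add]
  map_smul' c Y := by simp [Matrix.smul_mulVec]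

theorem posSemidef_map_vectorFunctional {k n : Type*} [Fintype n] [Fintype k] [DecidableEq k]
    (x : n → ℂ) {M : Matrix k k (Matrix n n ℂ)} (hM : (Matrix.comp k k n n ℂ M).PosSemidef) :
    (M.map (vectorFunctional x)).PosSemidef := by
  -- W is 1 ⊗ x, so applying the functional entrywise is compression by W.
  let W : Matrix (k × n) k ℂ := Matrix.of fun p b => if p.1 = b then x p.2 else 0
  have h : M.map (vectorFunctional x) = Wᴴ * Matrix.comp k k n n ℂ M * W := by
    ext a b
    simp only [Matrix.map_apply, vectorFunctional, LinearMap.coe_mk, AddHom.coe_mk, W,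
      Matrix.mul_apply, Matrix.conjTranspose_apply, Matrix.of_apply, Fintype.sum_prod_type,
      Matrix.comp_apply, dotProduct, Matrix.mulVec, Finset.sum_mul, Finset.mul_sum, Pi.star_apply]
    simp only [apply_ite star, star_zero, ite_mul, mul_ite, zero_mul, mul_zero,
      Finset.sum_ite_irrel, Finset.sum_const_zero, Finset.sum_ite_eq', Finset.mem_univ, if_true]
    rw [Finset.sum_comm]
    simp only [mul_assoc]
  rw [h]
  exact hM.conjTranspose_mul_mul_same W

/-- A convex combination of vector states realises z. Positivity at all matrix levels is recorded
for the use of φ in a completely positive map. -/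
theorem exists_functional_of_mem_convexHull_jointNumericalRange
    {A : Fin g → Matrix (Fin d) (Fin d) ℂ} {z : Fin g → ℝ}
    (hz : z ∈ convexHull ℝ (jointNumericalRange A)) :
    ∃ φ : Matrix (Fin d) (Fin d) ℂ →ₗ[ℂ] ℂ, φ 1 = 1 ∧
      (∀ (k : ℕ) (M : Matrix (Fin k) (Fin k) (Matrix (Fin d) (Fin d) ℂ)),
        (Matrix.comp (Fin k) (Fin k) (Fin d) (Fin d) ℂ M).PosSemidef → (M.map φ).PosSemidef) ∧
      ∀ i, φ (A i) = z i := by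
  obtain ⟨ι, _, w, p, hw0, hw1, hp, rfl⟩ := mem_convexHull_iff_exists_fintype.1 hz
  choose x hx hxp using hp
  refine ⟨∑ l, (w l : ℂ) • vectorFunctional (x l).ofLp, ?_, fun k M hM => ?_, fun i => ?_⟩
  · simp [vectorFunctional, EuclideanSpace.star_dotProduct_self_of_norm_eq_one (hx _),
      ← Complex.ofReal_sum, hw1]
  · have h : M.map ⇑(∑ l, (w l : ℂ) • vectorFunctional (x l).ofLp) =
        ∑ l, (w l : ℂ) • M.map (vectorFunctional (x l).ofLp) := by
      ext a b
      simp [Matrix.sum_apply]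
    rw [h]
    exact Matrix.posSemidef_sum _ fun l _ =>
      (posSemidef_map_vectorFunctional _ hM).smul (by exact_mod_cast hw0 l)
  · simp [vectorFunctional, ← hxp]

/-- Measure and prepare: the map Y ↦ ∑ φ_j(Y) Q_j is UCP, since its amplification is a sum of
Kronecker products of positive semidefinite matrices. -/
theorem minMatrixConvexSet_subset_matrixRange (A : Fin g → Matrix (Fin d) (Fin d) ℂ) (n : ℕ) :
    minMatrixConvexSet (convexHull ℝ (jointNumericalRange A)) n ⊆ matrixRange A n := by
  rintro X ⟨k, z, Q, hz, hQ, hX⟩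
  choose φ hφ1 hφ hφA using fun j =>
    exists_functional_of_mem_convexHull_jointNumericalRange (hz j)
  refine ⟨∑ j, (φ j).smulRight (Q j), ⟨?_, fun k' M hM => ?_⟩, fun i => ?_⟩
  · simp [hφ1, hQ.2]
  · have h : Matrix.comp (Fin k') (Fin k') (Fin n) (Fin n) ℂ
        (M.map ⇑(∑ j, (φ j).smulRight (Q j))) =
        ∑ j, Matrix.kronecker (M.map (φ j)) (Q j) := by
      ext ⟨a, i⟩ ⟨b, j⟩
      simp [Matrix.sum_apply, Matrix.kronecker]
    rw [h]
    exact Matrix.posSemidef_sum _ fun j _ => (hφ j k' M hM).kronecker (hQ.1 j)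
  · simp [hX, hφA]

end UCP

/-! ### Extreme points of finitely generated hulls -/

section FiniteHull

/-- Krein–Milman; the closure is superfluous because there are only finitely many extreme points. -/
theorem Set.Finite.convexHull_extremePoints_convexHull {E : Type*} [AddCommGroup E] [Module ℝ E]
    [TopologicalSpace E] [T2Space E] [IsTopologicalAddGroup E] [ContinuousSMul ℝ E]
    [LocallyConvexSpace ℝ E] {F : Set E} (hF : F.Finite) :
    convexHull ℝ ((convexHull ℝ F).extremePoints ℝ) = convexHull ℝ F := by
  have h := closure_convexHull_extremePoints (hF.isCompact_convexHull ℝ) (convex_convexHull ℝ F)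
  rwa [((hF.subset extremePoints_convexHull_subset).isClosed_convexHull ℝ).closure_eq] at h

/-- Removing an extreme point a leaves a convex set. If some z_j ≠ a had positive weight, the centre
of mass of all such z_j would lie in K \ {a} and yet equal a. -/
theorem eq_of_sum_smul_eq_extremePoint {E ι : Type*} [AddCommGroup E] [Module ℝ E] [Fintype ι]
    {K : Set E} (hK : Convex ℝ K) {a : E} (ha : a ∈ K.extremePoints ℝ) {w : ι → ℝ} {z : ι → E}
    (hw : ∀ j, 0 ≤ w j) (hw1 : ∑ j, w j = 1) (hz : ∀ j, z j ∈ K) (h : ∑ j, w j • z j = a)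
    {j : ι} (hj : w j ≠ 0) : z j = a := by
  classical
  by_contra hja
  have hdiff := (hK.mem_extremePoints_iff_convex_sdiff.1 ha).2
  let J : Finset ι := {l | z l ≠ a}
  have hs : 0 < ∑ l ∈ J, w l :=
    Finset.sum_pos' (fun l _ => hw l) ⟨j, by simp [J, hja], (hw j).lt_of_ne' hj⟩
  have hc : J.centerMass w z ∈ K \ {a} :=
    hdiff.centerMass_mem (fun l _ => hw l) hs fun l hl => ⟨hz l, by simpa [J] using hl⟩
  apply hc.2
  have h1 : ∑ l ∈ J, w l • z l + ∑ l ∈ Jᶜ, w l • z l = a := by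
    rw [Finset.sum_add_sum_compl, h]
  have h2 : ∑ l ∈ Jᶜ, w l • z l = (∑ l ∈ Jᶜ, w l) • a := by
    rw [Finset.sum_smul]
    refine Finset.sum_congr rfl fun l hl => ?_
    have : z l = a := by simpa [J] using hl
    rw [this]
  have h3 : ∑ l ∈ Jᶜ, w l = 1 - ∑ l ∈ J, w l := by
    rw [← hw1, ← Finset.sum_add_sum_compl J w]
    ring
  rw [h2, h3, sub_smul, one_smul] at h1
  have h4 : ∑ l ∈ J, w l • z l = (∑ l ∈ J, w l) • a := by
    have := sub_eq_zero.2 h1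
    rw [← sub_eq_zero]
    rw [← this]
    abel
  rw [Set.mem_singleton_iff, Finset.centerMass, h4, smul_smul, inv_mul_cancel₀ hs.ne', one_smul]

end FiniteHull

/-! ### Numerical range of a tuple with a POVM decomposition -/

section NumericalRange

variable {g d n : ℕ}

theorem mem_minMatrixConvexSet_conj {e : ℕ} {K : Set (Fin g → ℝ)}
    {A : Fin g → Matrix (Fin d) (Fin d) ℂ} (hA : A ∈ minMatrixConvexSet K d)
    {V : Matrix (Fin d) (Fin e) ℂ} (hV : Vᴴ * V = 1) :
    (fun i => Vᴴ * A i * V) ∈ minMatrixConvexSet K e := by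
  obtain ⟨k, z, Q, hz, hQ, hA⟩ := hA
  refine ⟨k, z, fun j => Vᴴ * Q j * V, hz, ⟨fun j => (hQ.1 j).conjTranspose_mul_mul_same V, ?_⟩,
    fun i => ?_⟩
  · rw [← Matrix.sum_mul, ← Matrix.mul_sum, hQ.2, Matrix.mul_one, hV]
  · simp [hA, Matrix.mul_sum, Matrix.sum_mul]

theorem Matrix.IsHermitian.coe_re_star_dotProduct_mulVec {M : Matrix (Fin d) (Fin d) ℂ}
    (hM : M.IsHermitian) (x : Fin d → ℂ) :
    (((star x ⬝ᵥ (M *ᵥ x)).re : ℝ) : ℂ) = star x ⬝ᵥ (M *ᵥ x) := by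
  apply Complex.ext
  · simp
  · have := hM.im_star_dotProduct_mulVec_self x
    simpa using this.symm

theorem re_mem_jointNumericalRange {A : Fin g → Matrix (Fin d) (Fin d) ℂ}
    (hA : ∀ i, (A i).IsHermitian) {x : EuclideanSpace ℂ (Fin d)} (hx : ‖x‖ = 1) :
    (fun i => (star x.ofLp ⬝ᵥ (A i *ᵥ x.ofLp)).re) ∈ jointNumericalRange A :=
  ⟨x, hx, fun i => (hA i).coe_re_star_dotProduct_mulVec _⟩

/-- The weights are ⟨x, Q_j x⟩; for positive semidefinite Q_j, a vanishing weight means Q_j x = 0.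
-/
theorem exists_weights_of_povm {k : ℕ} {z : Fin k → Fin g → ℝ}
    {Q : Fin k → Matrix (Fin d) (Fin d) ℂ} (hQ : IsPOVM Q) {A : Fin g → Matrix (Fin d) (Fin d) ℂ}
    (hA : ∀ i, A i = ∑ j, ((z j i : ℝ) : ℂ) • Q j) {x : EuclideanSpace ℂ (Fin d)} (hx : ‖x‖ = 1)
    {p : Fin g → ℝ} (hp : ∀ i, ((p i : ℝ) : ℂ) = star x.ofLp ⬝ᵥ (A i *ᵥ x.ofLp)) :
    ∃ w : Fin k → ℝ, (∀ j, 0 ≤ w j) ∧ ∑ j, w j = 1 ∧ ∑ j, w j • z j = p ∧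
      ∀ j, w j = 0 → Q j *ᵥ x.ofLp = 0 := by
  have hw : ∀ j, (((star x.ofLp ⬝ᵥ (Q j *ᵥ x.ofLp)).re : ℝ) : ℂ) =
      star x.ofLp ⬝ᵥ (Q j *ᵥ x.ofLp) := fun j => (hQ.1 j).1.coe_re_star_dotProduct_mulVec _
  refine ⟨fun j => (star x.ofLp ⬝ᵥ (Q j *ᵥ x.ofLp)).re, fun j => ?_, ?_, ?_, fun j hj => ?_⟩
  · exact (Complex.le_def.1 ((hQ.1 j).dotProduct_mulVec_nonneg x.ofLp)).1
  · apply Complex.ofReal_injective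
    rw [Complex.ofReal_sum]
    simp_rw [hw]
    rw [← dotProduct_sum, ← Matrix.sum_mulVec, hQ.2, Matrix.one_mulVec,
      EuclideanSpace.star_dotProduct_self_of_norm_eq_one hx, Complex.ofReal_one]
  · ext i
    apply Complex.ofReal_injective
    rw [hp, hA]
    simp [Matrix.sum_mulVec, dotProduct_sum, Matrix.smul_mulVec, hw, mul_comm]
  · rw [← (hQ.1 j).dotProduct_mulVec_zero_iff, ← hw]
    exact_mod_cast hj

theorem jointNumericalRange_subset_convexHull_range {k : ℕ} {z : Fin k → Fin g → ℝ}
    {Q : Fin k → Matrix (Fin d) (Fin d) ℂ} (hQ : IsPOVM Q) {A : Fin g → Matrix (Fin d) (Fin d) ℂ}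
    (hA : ∀ i, A i = ∑ j, ((z j i : ℝ) : ℂ) • Q j) :
    jointNumericalRange A ⊆ convexHull ℝ (Set.range z) := by
  rintro p ⟨x, hx, hp⟩
  obtain ⟨w, hw0, hw1, hwz, -⟩ := exists_weights_of_povm hQ hA hx hp
  exact mem_convexHull_of_exists_fintype w z hw0 hw1 (fun j => Set.mem_range_self j) hwz

theorem mulVec_eq_smul_of_extremePoint {K : Set (Fin g → ℝ)} (hK : Convex ℝ K)
    {A : Fin g → Matrix (Fin d) (Fin d) ℂ} (hA : A ∈ minMatrixConvexSet K d)
    {p : Fin g → ℝ} (hpK : p ∈ K.extremePoints ℝ) {x : EuclideanSpace ℂ (Fin d)} (hx : ‖x‖ = 1)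
    (hp : ∀ i, ((p i : ℝ) : ℂ) = star x.ofLp ⬝ᵥ (A i *ᵥ x.ofLp)) (i : Fin g) :
    A i *ᵥ x.ofLp = ((p i : ℝ) : ℂ) • x.ofLp := by
  obtain ⟨k, z, Q, hz, hQ, hA⟩ := hA
  obtain ⟨w, hw0, hw1, hwz, hw⟩ := exists_weights_of_povm hQ hA hx hp
  have h : ∀ j, (((z j i : ℝ) : ℂ) • Q j) *ᵥ x.ofLp = ((p i : ℝ) : ℂ) • (Q j *ᵥ x.ofLp) := by
    intro j
    rw [Matrix.smul_mulVec]
    by_cases hj : w j = 0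
    · rw [hw j hj, smul_zero, smul_zero]
    · rw [eq_of_sum_smul_eq_extremePoint hK hpK hw0 hw1 hz hwz hj]
  rw [hA, Matrix.sum_mulVec, Finset.sum_congr rfl fun j _ => h j, ← Finset.smul_sum,
    ← Matrix.sum_mulVec, hQ.2, Matrix.one_mulVec]

end NumericalRange

/-! ### Joint diagonalisation of commuting Hermitian matrices -/

section JointDiagonalisation

variable {g m : ℕ}

theorem exists_orthonormalBasis_mulVec_eq_smul {B : Fin g → Matrix (Fin m) (Fin m) ℂ}
    (hB : ∀ i, (B i).IsHermitian) (hc : ∀ i j, Commute (B i) (B j)) :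
    ∃ (b : OrthonormalBasis (Fin m) ℂ (EuclideanSpace ℂ (Fin m))) (c : Fin m → Fin g → ℂ),
      ∀ l i, B i *ᵥ (b l).ofLp = c l i • (b l).ofLp := by
  classical
  let T : Fin g → EuclideanSpace ℂ (Fin m) →ₗ[ℂ] EuclideanSpace ℂ (Fin m) :=
    fun i => Matrix.toEuclideanLin (B i)
  have hT : ∀ i, (T i).IsSymmetric := fun i => Matrix.isSymmetric_toEuclideanLin_iff.2 (hB i)
  have hTc : Pairwise (Function.onFun Commute T) := by
    intro i j _
    refine LinearMap.ext fun x => ?_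
    have := congrArg (fun M : Matrix (Fin m) (Fin m) ℂ => M *ᵥ x.ofLp) (hc i j).eq
    simp only [← Matrix.mulVec_mulVec] at this
    simp [T, Matrix.toLpLin_apply, this]
  let V : (Fin g → ℂ) → Submodule ℂ (EuclideanSpace ℂ (Fin m)) :=
    fun α => ⨅ j, Module.End.eigenspace (T j) (α j)
  have hV := LinearMap.IsSymmetric.directSum_isInternal_of_pairwise_commute hT hTc
  have hfam := LinearMap.IsSymmetric.orthogonalFamily_iInf_eigenspaces hT
  -- The family is indexed by all of ℂ^g; discarding the zero joint eigenspaces makes it finite, as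
  -- a subordinate basis requires.
  have hfin : {α | V α ≠ ⊥}.Finite := Submodule.finite_ne_bot_of_iSupIndep hV.submodule_iSupIndep
  have : Fintype {α // V α ≠ ⊥} := hfin.fintype
  have hV' : DirectSum.IsInternal fun α : {α // V α ≠ ⊥} => V α :=
    DirectSum.isInternal_ne_bot_iff.2 hV
  have hfam' := hfam.comp (Subtype.val_injective (p := fun α => V α ≠ ⊥))
  have hn : Module.finrank ℂ (EuclideanSpace ℂ (Fin m)) = m := finrank_euclideanSpace_fin
  refine ⟨hV'.subordinateOrthonormalBasis hn hfam',
    fun l => (hV'.subordinateOrthonormalBasisIndex hn l hfam').1, fun l i => ?_⟩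
  have h := hV'.subordinateOrthonormalBasis_subordinate hn l hfam'
  have h' := Module.End.mem_eigenspace_iff.1 ((Submodule.mem_iInf _).1 h i)
  simpa [T, Matrix.toLpLin_apply] using congrArg WithLp.ofLp h'

end JointDiagonalisation

/-! ### Splitting off the commuting part -/

section Decomposition

variable {g d m e : ℕ}

theorem convexHull_realToComplex_image (S : Set (Fin g → ℝ)) :
    convexHull ℝ (realToComplex '' S) = realToComplex '' convexHull ℝ S := by
  let f : (Fin g → ℝ) →ₗ[ℝ] (Fin g → ℂ) :=
    { toFun := realToComplex
      map_add' := fun x y => by ext i; simp [realToComplex]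
      map_smul' := fun c x => by ext i; simp [realToComplex] }
  exact (f.image_convexHull S).symm

theorem jointSpectrum_diagonal (c : Fin m → Fin g → ℂ) :
    jointSpectrum (fun i => Matrix.diagonal fun a => c a i) = Set.range c := by
  ext l
  constructor
  · rintro ⟨x, hx, h⟩
    obtain ⟨a, ha⟩ := Function.ne_iff.1 hx
    refine ⟨a, funext fun i => ?_⟩
    have := congrFun (h i) a
    rw [Matrix.mulVec_diagonal] at this
    exact mul_right_cancel₀ ha this
  · rintro ⟨a, rfl⟩
    refine ⟨Pi.single a 1, by simp, fun i => ?_⟩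
    ext b
    rw [Matrix.mulVec_diagonal]
    by_cases h : b = a
    · subst h
      simp
    · simp [h]

theorem Matrix.IsHermitian.inner_eq_zero_of_mulVec_eq_smul {M : Matrix (Fin d) (Fin d) ℂ}
    (hM : M.IsHermitian) {x y : EuclideanSpace ℂ (Fin d)} {a b : ℝ}
    (hx : M *ᵥ x.ofLp = (a : ℂ) • x.ofLp) (hy : M *ᵥ y.ofLp = (b : ℂ) • y.ofLp) (hab : a ≠ b) :
    inner ℂ x y = 0 := by
  have hsymm := Matrix.isSymmetric_toEuclideanLin_iff.2 hM
  have h1 : Matrix.toEuclideanLin M x = (a : ℂ) • x := by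
    ext i
    simpa [Matrix.toLpLin_apply] using congrFun hx i
  have h2 : Matrix.toEuclideanLin M y = (b : ℂ) • y := by
    ext i
    simpa [Matrix.toLpLin_apply] using congrFun hy i
  have h := hsymm x y
  rw [h1, h2, inner_smul_left, inner_smul_right, Complex.conj_ofReal, ← sub_eq_zero,
    ← sub_mul] at h
  refine (mul_eq_zero.1 h).resolve_left (sub_ne_zero.2 ?_)
  exact_mod_cast hab

/-- The matrix whose columns are the vectors of an orthonormal basis. -/
noncomputable def OrthonormalBasis.columns {ι : Type*} [Fintype ι]
    (b : OrthonormalBasis ι ℂ (EuclideanSpace ℂ (Fin d))) : Matrix (Fin d) ι ℂ :=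
  Matrix.of fun p j => (b j).ofLp p

theorem OrthonormalBasis.columns_mul_conjTranspose {ι : Type*} [Fintype ι]
    (b : OrthonormalBasis ι ℂ (EuclideanSpace ℂ (Fin d))) : b.columns * b.columnsᴴ = 1 := by
  rw [← b.sum_vecMulVec_star]
  ext p q
  simp [columns, Matrix.mul_apply, Matrix.sum_apply, Matrix.vecMulVec_apply]

theorem OrthonormalBasis.conjTranspose_columns_mul {ι : Type*} [Fintype ι] [DecidableEq ι]
    (b : OrthonormalBasis ι ℂ (EuclideanSpace ℂ (Fin d))) : b.columnsᴴ * b.columns = 1 := by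
  ext j l
  have h := orthonormal_iff_ite.1 b.orthonormal j l
  rw [EuclideanSpace.inner_eq_star_dotProduct, dotProduct_comm] at h
  rw [Matrix.one_apply, ← h]
  simp [columns, Matrix.mul_apply, dotProduct]

theorem exists_unitarily_equivalent_diagonal_sum {A : Fin g → Matrix (Fin d) (Fin d) ℂ}
    (hA : ∀ i, (A i).IsHermitian) {x : Fin m → EuclideanSpace ℂ (Fin d)} (hx : Orthonormal ℂ x)
    {c : Fin m → Fin g → ℝ} (hc : ∀ a i, A i *ᵥ (x a).ofLp = ((c a i : ℝ) : ℂ) • (x a).ofLp) :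
    ∃ (e : ℕ) (V : Matrix (Fin d) (Fin e) ℂ), Vᴴ * V = 1 ∧
      IsUnitarilyEquivalentToSum A
        (fun i => Matrix.diagonal fun a => ((c a i : ℝ) : ℂ)) (fun i => Vᴴ * A i * V) := by
  have hmd : m ≤ d := by simpa using hx.linearIndependent.fintype_card_le_finrank
  have hcard : Module.finrank ℂ (EuclideanSpace ℂ (Fin d)) =
      Fintype.card (Fin m ⊕ Fin (d - m)) := by simp [hmd]
  -- The zeros are placeholders: only the left summand is prescribed when extending to a basis.
  let v : Fin m ⊕ Fin (d - m) → EuclideanSpace ℂ (Fin d) := Sum.elim x 0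
  have hv : Orthonormal ℂ ((Set.range Sum.inl).domRestrict v) := by
    have h : (Set.range (Sum.inl : Fin m → Fin m ⊕ Fin (d - m))).domRestrict v =
        x ∘ (Equiv.ofInjective _ Sum.inl_injective).symm := by
      ext1 ⟨_, a, rfl⟩
      have : (Equiv.ofInjective _ Sum.inl_injective).symm
          (⟨Sum.inl a, a, rfl⟩ : Set.range (Sum.inl : Fin m → Fin m ⊕ Fin (d - m))) = a :=
        Equiv.ofInjective_symm_apply Sum.inl_injective a
      simp [v, this]
    rw [h]
    exact hx.comp _ (Equiv.injective _)
  obtain ⟨b, hb⟩ := hv.exists_orthonormalBasis_extension_of_card_eq hcard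
  have hbl : ∀ a, b (Sum.inl a) = x a := fun a => hb _ ⟨a, rfl⟩
  let U := b.columns
  have hU : Uᴴ * U = 1 := b.conjTranspose_columns_mul
  have hU' : U * Uᴴ = 1 := b.columns_mul_conjTranspose
  have hcol : ∀ i j a, (Uᴴ * A i * U) j (Sum.inl a) =
      if j = Sum.inl a then ((c a i : ℝ) : ℂ) else 0 := by
    intro i j a
    have h1 : ∀ p, (A i * U) p (Sum.inl a) = ((c a i : ℝ) : ℂ) * U p (Sum.inl a) := by
      intro p
      have := congrFun (hc a i) p
      rw [← hbl] at this
      exact this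
    have h2 : (Uᴴ * U) j (Sum.inl a) = if j = Sum.inl a then 1 else 0 := by
      rw [hU, Matrix.one_apply]
    rw [Matrix.mul_assoc, Matrix.mul_apply]
    simp_rw [h1]
    rw [Matrix.mul_apply] at h2
    calc _ = ((c a i : ℝ) : ℂ) * ∑ p, Uᴴ j p * U p (Sum.inl a) := by
          rw [Finset.mul_sum]
          exact Finset.sum_congr rfl fun p _ => by ring
      _ = _ := by rw [h2]; simp
  have hherm : ∀ i, (Uᴴ * A i * U).IsHermitian := fun i =>
    Matrix.isHermitian_conjTranspose_mul_mul U (hA i)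
  refine ⟨d - m, U.submatrix id Sum.inr, ?_, U, hU, hU', fun i => ?_⟩
  · ext j l
    have h := congrFun (congrFun hU (Sum.inr j)) (Sum.inr l)
    rw [Matrix.one_apply] at h
    simpa [Matrix.mul_apply, Matrix.one_apply] using h
  · have h : Matrix.fromBlocks (Matrix.diagonal fun a => ((c a i : ℝ) : ℂ)) 0 0
        ((U.submatrix id Sum.inr)ᴴ * A i * U.submatrix id Sum.inr) = Uᴴ * A i * U := by
      ext j l
      rcases l with l | l
      · rw [hcol]
        rcases j with j | j
        · by_cases h : j = l
          · simp [h]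
          · simp [h]
        · simp
      · rcases j with j | j
        · rw [← (hherm i).apply, hcol]
          simp
        · simp [Matrix.mul_apply]
    calc A i = (U * Uᴴ) * A i * (U * Uᴴ) := by rw [hU', Matrix.one_mul, Matrix.mul_one]
      _ = _ := by rw [h]; simp only [Matrix.mul_assoc]

theorem HasDeterminingCommutingPart.of_mem_minMatrixConvexSet
    {A : Fin g → Matrix (Fin d) (Fin d) ℂ} (hA : ∀ i, (A i).IsHermitian)
    (h : A ∈ minMatrixConvexSet (convexHull ℝ (jointNumericalRange A)) d) :
    HasDeterminingCommutingPart A := by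
  set K := convexHull ℝ (jointNumericalRange A) with hK
  have hKc : Convex ℝ K := convex_convexHull _ _
  have hmem := h
  obtain ⟨k, z, Q, hz, hQ, hAz⟩ := h
  have hKz : K = convexHull ℝ (Set.range z) :=
    (convexHull_min (jointNumericalRange_subset_convexHull_range hQ hAz)
      (convex_convexHull _ _)).antisymm (convexHull_min (Set.range_subset_iff.2 hz) hKc)
  have hfin : (K.extremePoints ℝ).Finite := by
    rw [hKz]
    exact (Set.finite_range z).subset extremePoints_convexHull_subset
  have hKext : convexHull ℝ (K.extremePoints ℝ) = K := by
    rw [hKz]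
    exact (Set.finite_range z).convexHull_extremePoints_convexHull
  have := hfin.fintype
  let f := (Fintype.equivFin (K.extremePoints ℝ)).symm
  -- Extreme points of conv 𝒲(A) already lie in 𝒲(A).
  have hx : ∀ a, ∃ x : EuclideanSpace ℂ (Fin d), ‖x‖ = 1 ∧
      ∀ i, ((((f a).1 i : ℝ)) : ℂ) = star x.ofLp ⬝ᵥ (A i *ᵥ x.ofLp) :=
    fun a => extremePoints_convexHull_subset (A := jointNumericalRange A) (f a).2
  choose x hx1 hx using hx
  have hxA : ∀ a i, A i *ᵥ (x a).ofLp = (((f a).1 i : ℝ) : ℂ) • (x a).ofLp := fun a i =>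
    mulVec_eq_smul_of_extremePoint hKc hmem (f a).2 (hx1 a) (hx a) i
  have horth : Orthonormal ℂ x := by
    refine ⟨hx1, fun a b hab => ?_⟩
    have hne : (f a).1 ≠ (f b).1 := fun h => hab (f.injective (Subtype.ext h))
    obtain ⟨i, hi⟩ := Function.ne_iff.1 hne
    exact (hA i).inner_eq_zero_of_mulVec_eq_smul (hxA a i) (hxA b i) hi
  obtain ⟨e, V, hV, hU⟩ := exists_unitarily_equivalent_diagonal_sum hA horth hxA
  refine ⟨_, e, _, _, hU, fun i => ?_, fun i j => ?_, ?_,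
    matrixRange_subset_minMatrixConvexSet (mem_minMatrixConvexSet_conj hmem hV)⟩
  · rw [isStarNormal_iff]
    simp [Matrix.star_eq_conjTranspose, Matrix.diagonal_conjTranspose, Commute, SemiconjBy,
      Matrix.diagonal_mul_diagonal]
  · simp [Commute, SemiconjBy, Matrix.diagonal_mul_diagonal, mul_comm]
  · have hspec := jointSpectrum_diagonal fun a => realToComplex (f a).1
    simp only [realToComplex] at hspec
    rw [hspec, ← hK, show realToComplex '' K = realToComplex '' convexHull ℝ (K.extremePoints ℝ) by
      rw [hKext], ← convexHull_realToComplex_image]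
    congr 1
    ext l
    constructor
    · rintro ⟨a, rfl⟩
      exact ⟨_, (f a).2, rfl⟩
    · rintro ⟨p, hp, rfl⟩
      exact ⟨f.symm ⟨p, hp⟩, by simp⟩

theorem HasDeterminingCommutingPart.mem_minMatrixConvexSet
    {A : Fin g → Matrix (Fin d) (Fin d) ℂ} (hA : ∀ i, (A i).IsHermitian)
    (h : HasDeterminingCommutingPart A) :
    A ∈ minMatrixConvexSet (convexHull ℝ (jointNumericalRange A)) d := by
  obtain ⟨m, e, B, E, ⟨U, hU, hU', hAU⟩, -, hBc, hspec, hE⟩ := h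
  obtain ⟨k, z, Q, hz, hQ, hEz⟩ := hE e (mem_matrixRange_self E)
  -- B is a diagonal block of the Hermitian tuple U* A U.
  have hB : ∀ i, (B i).IsHermitian := by
    intro i
    have h : Uᴴ * A i * U = Matrix.fromBlocks (B i) 0 0 (E i) := by
      calc Uᴴ * A i * U = (Uᴴ * U) * Matrix.fromBlocks (B i) 0 0 (E i) * (Uᴴ * U) := by
            rw [hAU]; simp only [Matrix.mul_assoc]
        _ = _ := by rw [hU, Matrix.one_mul, Matrix.mul_one]
    have h' := Matrix.isHermitian_conjTranspose_mul_mul U (hA i)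
    rw [h] at h'
    exact (Matrix.isHermitian_fromBlocks_iff.1 h').1
  obtain ⟨b, c, hbc⟩ := exists_orthonormalBasis_mulVec_eq_smul hB hBc
  have hc : ∀ l, ∃ y ∈ convexHull ℝ (jointNumericalRange A), realToComplex y = c l := by
    intro l
    have : c l ∈ convexHull ℝ (jointSpectrum B) := by
      refine subset_convexHull _ _ ⟨(b l).ofLp, fun h => ?_, hbc l⟩
      exact b.toBasis.ne_zero l (by simpa using congrArg (WithLp.toLp 2) h)
    rwa [hspec] at this
  choose y hy hyc using hc
  have hBsum : ∀ i, B i = ∑ l, ((y l i : ℝ) : ℂ) •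
      Matrix.vecMulVec (b l).ofLp (star (b l).ofLp) := by
    intro i
    refine b.eq_sum_smul_vecMulVec_star fun l => ?_
    rw [hbc, ← hyc]
    rfl
  set U₁ := U.toCols₁ with hU₁
  set U₂ := U.toCols₂ with hU₂
  have hsplit : ∀ (M : Matrix (Fin m) (Fin m) ℂ) (N : Matrix (Fin e) (Fin e) ℂ),
      U * Matrix.fromBlocks M 0 0 N * Uᴴ = U₁ * M * U₁ᴴ + U₂ * N * U₂ᴴ := by
    intro M N
    rw [← Matrix.fromCols_toCols U, Matrix.fromCols_mul_fromBlocks,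
      Matrix.conjTranspose_fromCols_eq_fromRows_conjTranspose, Matrix.fromCols_mul_fromRows]
    simp [hU₁, hU₂]
  refine mem_minMatrixConvexSet_of_fintype (Sum.elim y z)
    (Sum.elim (fun l => U₁ * Matrix.vecMulVec (b l).ofLp (star (b l).ofLp) * U₁ᴴ)
      fun j => U₂ * Q j * U₂ᴴ) ?_ ?_ ?_ fun i => ?_
  · rintro (l | j)
    exacts [hy l, hz j]
  · rintro (l | j)
    · exact (Matrix.posSemidef_vecMulVec_self_star _).mul_mul_conjTranspose_same U₁
    · exact (hQ.1 j).mul_mul_conjTranspose_same U₂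
  · rw [Fintype.sum_sum_type]
    simp only [Sum.elim_inl, Sum.elim_inr]
    rw [← Matrix.sum_mul, ← Matrix.mul_sum, ← Matrix.sum_mul, ← Matrix.mul_sum,
      b.sum_vecMulVec_star, hQ.2, ← hsplit, Matrix.fromBlocks_one, Matrix.mul_one, hU']
  · rw [Fintype.sum_sum_type, hAU, hsplit, hBsum, hEz]
    simp [Matrix.mul_sum, Matrix.sum_mul]

end Decomposition

/-! ### Compactness of convex hulls in finite dimension -/

section CompactHull

/-- By Carathéodory, dim E + 1 points suffice, so the hull is a continuous image of a simplex times
a power of s. -/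
theorem IsCompact.convexHull_of_finiteDimensional {E : Type*} [AddCommGroup E] [Module ℝ E]
    [TopologicalSpace E] [ContinuousAdd E] [ContinuousSMul ℝ E] [FiniteDimensional ℝ E]
    {s : Set E} (hs : IsCompact s) : IsCompact (convexHull ℝ s) := by
  rcases s.eq_empty_or_nonempty with rfl | ⟨x₀, hx₀⟩
  · simp
  let N := Module.finrank ℝ E + 1
  let f : (Fin N → ℝ) × (Fin N → E) → E := fun q => ∑ i, q.1 i • q.2 i
  have hf : Continuous f := by fun_prop
  have hcomp : IsCompact (f '' (stdSimplex ℝ (Fin N) ×ˢ Set.univ.pi fun _ => s)) :=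
    ((isCompact_stdSimplex ℝ (Fin N)).prod (isCompact_univ_pi fun _ => hs)).image hf
  convert hcomp
  apply Set.Subset.antisymm
  · intro x hx
    obtain ⟨ι, _, z, w, hz, hind, hw0, hw1, hwz⟩ := eq_pos_convex_span_of_mem_convexHull hx
    have hcard : Fintype.card ι ≤ N := hind.card_le_finrank_succ.trans
      (Nat.succ_le_succ (Submodule.finrank_le _))
    obtain ⟨φ⟩ : Nonempty (ι ↪ Fin N) :=
      Function.Embedding.nonempty_of_card_le (by simpa using hcard)
    have hout : ∀ n, n ∉ Set.range φ → Function.extend φ w 0 n = 0 := fun n hn =>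
      Function.extend_apply' _ _ _ hn
    -- Shorter combinations are padded with x₀ at weight zero.
    refine ⟨(Function.extend φ w 0, Function.extend φ z fun _ => x₀), ⟨⟨fun n => ?_, ?_⟩, ?_⟩, ?_⟩
    · by_cases hn : n ∈ Set.range φ
      · obtain ⟨i, rfl⟩ := hn
        simpa [φ.injective.extend_apply] using (hw0 i).le
      · simp [hout n hn]
    · change ∑ n, Function.extend φ w 0 n = 1
      rw [← hw1]
      exact (Fintype.sum_of_injective φ φ.injective _ _ hout fun i =>
        (φ.injective.extend_apply _ _ _).symm).symm
    · intro n _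
      by_cases hn : n ∈ Set.range φ
      · obtain ⟨i, rfl⟩ := hn
        simpa [φ.injective.extend_apply] using hz ⟨i, rfl⟩
      · simpa [Function.extend_apply' _ _ _ hn] using hx₀
    · change ∑ n, Function.extend φ w 0 n • Function.extend φ z (fun _ => x₀) n = x
      rw [← hwz]
      refine (Fintype.sum_of_injective φ φ.injective _ _ (fun n hn => ?_) fun i => ?_).symm
      · rw [hout n hn, zero_smul]
      · rw [φ.injective.extend_apply, φ.injective.extend_apply]
  · rintro _ ⟨⟨w, z⟩, ⟨hw, hz⟩, rfl⟩
    exact mem_convexHull_of_exists_fintype w z hw.1 hw.2 (fun i => hz i trivial) rfl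

end CompactHull

/-! ### Closedness of the minimal matrix convex set -/

section Closedness

variable {g d : ℕ}

theorem isCompact_jointNumericalRange (A : Fin g → Matrix (Fin d) (Fin d) ℂ)
    (hA : ∀ i, (A i).IsHermitian) : IsCompact (jointNumericalRange A) := by
  have h : jointNumericalRange A = (fun (x : EuclideanSpace ℂ (Fin d)) i =>
      (star x.ofLp ⬝ᵥ (A i *ᵥ x.ofLp)).re) '' Metric.sphere 0 1 := by
    apply Set.Subset.antisymm
    · rintro p ⟨x, hx, hp⟩
      refine ⟨x, by simpa using hx, funext fun i => ?_⟩
      simp only [← hp, Complex.ofReal_re]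
    · rintro _ ⟨x, hx, rfl⟩
      exact re_mem_jointNumericalRange hA (by simpa using hx)
  rw [h]
  refine (isCompact_sphere _ _).image ?_
  refine continuous_pi fun i => Complex.continuous_re.comp ?_
  simp only [dotProduct, Matrix.mulVec, Pi.star_apply]
  fun_prop

/-- The pairs `(x x*, z ⊗ x x*)` with `x` a unit vector and `z ∈ K`. -/
def rankOneTensors (d : ℕ) (K : Set (Fin g → ℝ)) :
    Set (Matrix (Fin d) (Fin d) ℂ × (Fin g → Matrix (Fin d) (Fin d) ℂ)) :=
  (fun q : EuclideanSpace ℂ (Fin d) × (Fin g → ℝ) =>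
    (Matrix.vecMulVec q.1.ofLp (star q.1.ofLp),
      fun i => ((q.2 i : ℝ) : ℂ) • Matrix.vecMulVec q.1.ofLp (star q.1.ofLp))) ''
    (Metric.sphere 0 1 ×ˢ K)

theorem isCompact_rankOneTensors {K : Set (Fin g → ℝ)} (hK : IsCompact K) :
    IsCompact (rankOneTensors d K) := by
  refine ((isCompact_sphere _ _).prod hK).image ?_
  have h : Continuous fun q : EuclideanSpace ℂ (Fin d) × (Fin g → ℝ) =>
      Matrix.vecMulVec q.1.ofLp (star q.1.ofLp) := by
    refine continuous_matrix fun a b => ?_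
    simp only [Matrix.vecMulVec_apply, Pi.star_apply]
    fun_prop
  refine h.prodMk (continuous_pi fun i => ?_)
  exact (Complex.continuous_ofReal.comp ((continuous_apply i).comp continuous_snd)).smul h

/-- Spectral decomposition refines a POVM to rank-one terms μ u u*. Taking traces, the weights μ sum
to d, hence the factor 1/d. The first component encodes the normalisation ∑ Q_j = 1. -/
theorem mem_minMatrixConvexSet_iff_mem_convexHull_rankOneTensors (hd : d ≠ 0)
    {K : Set (Fin g → ℝ)} {X : Fin g → Matrix (Fin d) (Fin d) ℂ} :
    X ∈ minMatrixConvexSet K d ↔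
      (d : ℝ)⁻¹ • ((1 : Matrix (Fin d) (Fin d) ℂ), X) ∈ convexHull ℝ (rankOneTensors d K) := by
  have hd' : (d : ℝ) ≠ 0 := by exact_mod_cast hd
  constructor
  · rintro ⟨k, z, Q, hz, hQ, hX⟩
    choose μ u hμ hu hQu using fun j => (hQ.1 j).exists_eq_sum_smul_vecMulVec_star
    have hone : ∑ j, ∑ l, (μ j l : ℂ) •
        Matrix.vecMulVec (u j l).ofLp (star (u j l).ofLp) = 1 := by
      rw [← hQ.2]
      exact Finset.sum_congr rfl fun j _ => (hQu j).symm
    refine mem_convexHull_of_exists_fintype (ι := Fin k × Fin d) (fun q => (d : ℝ)⁻¹ * μ q.1 q.2)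
      (fun q => (Matrix.vecMulVec (u q.1 q.2).ofLp (star (u q.1 q.2).ofLp),
        fun i => ((z q.1 i : ℝ) : ℂ) •
          Matrix.vecMulVec (u q.1 q.2).ofLp (star (u q.1 q.2).ofLp)))
      (fun q => mul_nonneg (by positivity) (hμ _ _)) ?_ (fun q => ?_) ?_
    · rw [← Finset.mul_sum, Fintype.sum_prod_type]
      have h := congrArg Matrix.trace hone
      simp only [Matrix.trace_sum, Matrix.trace_smul,
        EuclideanSpace.trace_vecMulVec_star_of_norm_eq_one (hu _ _), Matrix.trace_one,
        Fintype.card_fin, smul_eq_mul, mul_one] at h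
      have h' : ∑ j, ∑ l, μ j l = (d : ℝ) := by exact_mod_cast h
      rw [h', inv_mul_cancel₀ hd']
    · exact ⟨(u q.1 q.2, z q.1), ⟨by simpa using hu _ _, hz _⟩, rfl⟩
    · simp_rw [mul_smul, ← Finset.smul_sum]
      congr 1
      rw [Fintype.sum_prod_type]
      refine Prod.ext ?_ (funext fun i => ?_)
      · rw [← hone]
        simp [Prod.fst_sum]
      · change _ = X i
        rw [hX i]
        simp only [Prod.snd_sum, Finset.sum_apply, Prod.smul_snd, Pi.smul_apply]
        refine Finset.sum_congr rfl fun j _ => ?_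
        rw [hQu j, Finset.smul_sum]
        refine Finset.sum_congr rfl fun l _ => ?_
        rw [smul_comm]
        simp
  · intro h
    obtain ⟨ι, _, w, s, hw0, hw1, hs, h⟩ := mem_convexHull_iff_exists_fintype.1 h
    choose q hq hqs using hs
    have h2 : ((1 : Matrix (Fin d) (Fin d) ℂ), X) = ∑ j, ((d : ℝ) * w j) • s j := by
      simp_rw [mul_smul]
      rw [← Finset.smul_sum, h, smul_smul, mul_inv_cancel₀ hd', one_smul]
    refine mem_minMatrixConvexSet_of_fintype (fun j => (q j).2)
      (fun j => (((d : ℝ) * w j : ℝ) : ℂ) •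
        Matrix.vecMulVec (q j).1.ofLp (star (q j).1.ofLp)) (fun j => (hq j).2) (fun j => ?_) ?_
      fun i => ?_
    · refine (Matrix.posSemidef_vecMulVec_self_star _).smul ?_
      exact_mod_cast mul_nonneg (Nat.cast_nonneg d) (hw0 j)
    · have h3 := congrArg Prod.fst h2
      simp only [Prod.fst_sum, Prod.smul_fst, ← hqs] at h3
      rw [h3]
      rfl
    · have h3 := congrFun (congrArg Prod.snd h2) i
      simp only [Prod.snd_sum, Finset.sum_apply, Prod.smul_snd, Pi.smul_apply, ← hqs] at h3
      rw [h3]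
      refine Finset.sum_congr rfl fun j _ => ?_
      rw [smul_comm]
      rfl

theorem isClosed_minMatrixConvexSet (hd : d ≠ 0) {K : Set (Fin g → ℝ)} (hK : IsCompact K) :
    IsClosed (minMatrixConvexSet K d) := by
  have h : minMatrixConvexSet K d =
      (fun X => (d : ℝ)⁻¹ • ((1 : Matrix (Fin d) (Fin d) ℂ), X)) ⁻¹'
        convexHull ℝ (rankOneTensors d K) :=
    Set.ext fun X => mem_minMatrixConvexSet_iff_mem_convexHull_rankOneTensors hd
  rw [h]
  exact (isCompact_rankOneTensors hK).convexHull_of_finiteDimensional.isClosed.preimage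
    (by fun_prop)

end Closedness

/-! ### Polytope operators and approximation by polytopes -/

section Polytopes

open scoped Pointwise

variable {g d : ℕ}

/-- A functional f < u on P separating a point of 𝒲(A) has u > 0 because 0 ∈ P, so f/u lies in P°;
testing it on the pure state x x* gives a contradiction. -/
theorem IsPolytopeOperators.jointNumericalRange_subset {P : Set (Fin g → ℝ)}
    (hPc : Convex ℝ P) (hPcl : IsClosed P) (hP0 : (0 : Fin g → ℝ) ∈ P)
    {A : Fin g → Matrix (Fin d) (Fin d) ℂ} (h : IsPolytopeOperators P A) :
    jointNumericalRange A ⊆ P := by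
  rintro p ⟨x, hx, hp⟩
  by_contra hpP
  obtain ⟨f, u, hfu, hup⟩ := geometric_hahn_banach_closed_point hPc hPcl hpP
  have hu : 0 < u := by simpa using hfu 0 hP0
  have hf : ∀ y, (fun i => u⁻¹ * f (Pi.single i 1)) ⬝ᵥ y = u⁻¹ * f y := by
    intro y
    have := f.toLinearMap.pi_apply_eq_sum_univ y
    simp only [ContinuousLinearMap.coe_coe] at this
    rw [this, Finset.mul_sum, dotProduct]
    refine Finset.sum_congr rfl fun i _ => ?_
    rw [smul_eq_mul, mul_assoc, mul_comm (f _)]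
    congr 4
    ext j
    simp [Pi.single_apply, eq_comm]
  have hρ : IsDensityMatrix (Matrix.vecMulVec x.ofLp (star x.ofLp)) :=
    ⟨Matrix.posSemidef_vecMulVec_self_star _,
      EuclideanSpace.trace_vecMulVec_star_of_norm_eq_one hx⟩
  have h1 := h (fun i => u⁻¹ * f (Pi.single i 1)) (fun y hy => by
    rw [hf, inv_mul_le_iff₀ hu, mul_one]
    exact (hfu y hy).le) _ hρ
  simp_rw [Matrix.trace_mul_vecMulVec_star, ← hp, Complex.ofReal_re] at h1
  have h2 := hf p
  rw [dotProduct] at h2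
  rw [h2, inv_mul_le_iff₀ hu, mul_one] at h1
  exact absurd hup (not_lt.2 h1)

theorem isPolytopeOperators_of_jointNumericalRange_subset {P : Set (Fin g → ℝ)}
    {A : Fin g → Matrix (Fin d) (Fin d) ℂ} (hA : ∀ i, (A i).IsHermitian)
    (h : jointNumericalRange A ⊆ P) : IsPolytopeOperators P A := by
  rintro η hη ρ ⟨hρ, hρ1⟩
  obtain ⟨μ, u, hμ, hu, rfl⟩ := hρ.exists_eq_sum_smul_vecMulVec_star
  have hμ1 : ∑ l, μ l = 1 := by
    simp only [Matrix.trace_sum, Matrix.trace_smul,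
      EuclideanSpace.trace_vecMulVec_star_of_norm_eq_one (hu _), smul_eq_mul, mul_one] at hρ1
    exact_mod_cast hρ1
  have htr : ∀ i, ((A i * ∑ l, (μ l : ℂ) •
      Matrix.vecMulVec (u l).ofLp (star (u l).ofLp)).trace).re =
      ∑ l, μ l * (star (u l).ofLp ⬝ᵥ (A i *ᵥ (u l).ofLp)).re := by
    intro i
    simp [Matrix.mul_sum, Matrix.trace_sum, Matrix.trace_mul_vecMulVec_star]
  simp_rw [htr, Finset.mul_sum]
  rw [Finset.sum_comm, ← hμ1]
  refine Finset.sum_le_sum fun l _ => ?_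
  have hl := hη _ (h (re_mem_jointNumericalRange hA (hu l)))
  calc _ = μ l * (η ⬝ᵥ fun i => (star (u l).ofLp ⬝ᵥ (A i *ᵥ (u l).ofLp)).re) := by
        rw [dotProduct, Finset.mul_sum]
        exact Finset.sum_congr rfl fun i _ => by ring
    _ ≤ μ l := mul_le_of_le_one_right (hμ l) hl

theorem exists_isPolytopeWithVertices_convexHull {F : Set (Fin g → ℝ)} (hF : F.Finite) :
    ∃ (k : ℕ) (v : Fin k → Fin g → ℝ), IsPolytopeWithVertices (convexHull ℝ F) v := by
  have hfin : ((convexHull ℝ F).extremePoints ℝ).Finite :=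
    hF.subset extremePoints_convexHull_subset
  have := hfin.fintype
  let f := (Fintype.equivFin ((convexHull ℝ F).extremePoints ℝ)).symm
  have hr : Set.range (fun a => (f a).1) = (convexHull ℝ F).extremePoints ℝ := by
    rw [show (fun a => (f a).1) = Subtype.val ∘ f from rfl, f.surjective.range_comp,
      Subtype.range_coe]
  refine ⟨_, fun a => (f a).1, Subtype.val_injective.comp f.injective, hr, ?_⟩
  rw [hr, hF.convexHull_extremePoints_convexHull]

/-- Each point of K is interior to a simplex inside C; by compactness finitely many simplices cover
K, and their vertices form F. -/
theorem exists_polytope_between {K C : Set (Fin g → ℝ)} (hK : IsCompact K) (hC : Convex ℝ C)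
    (hKC : K ⊆ interior C) :
    ∃ F : Set (Fin g → ℝ), F.Finite ∧ K ⊆ convexHull ℝ F ∧ convexHull ℝ F ⊆ C := by
  have h : ∀ x ∈ K, ∃ F : Set (Fin g → ℝ), F.Finite ∧ x ∈ interior (convexHull ℝ F) ∧
      convexHull ℝ F ⊆ C := by
    intro x hx
    obtain ⟨b, hb, hbC⟩ :=
      exists_mem_interior_convexHull_affineBasis (mem_interior_iff_mem_nhds.1 (hKC hx))
    exact ⟨Set.range b, Set.finite_range b, hb, hbC⟩
  choose! F hF hxF hFC using h
  obtain ⟨t, hKt⟩ := hK.elim_nhds_subcover' (fun x _ => interior (convexHull ℝ (F x)))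
    fun x hx => isOpen_interior.mem_nhds (hxF x hx)
  refine ⟨⋃ x ∈ t, F x, t.finite_toSet.biUnion fun x _ => hF x x.2, fun y hy => ?_,
    convexHull_min (Set.iUnion₂_subset fun x _ => (subset_convexHull ℝ _).trans (hFC x x.2)) hC⟩
  obtain ⟨x, hx, hyx⟩ := Set.mem_iUnion₂.1 (hKt hy)
  exact convexHull_mono (Set.subset_iUnion₂ (s := fun (x : K) (_ : x ∈ t) => F x) x hx)
    (interior_subset hyx)

theorem inv_smul_mem_minMatrixConvexSet {K : Set (Fin g → ℝ)} {t : ℝ} (ht : t ≠ 0)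
    {X : Fin g → Matrix (Fin d) (Fin d) ℂ} (hX : X ∈ minMatrixConvexSet (t • K) d) :
    t⁻¹ • X ∈ minMatrixConvexSet K d := by
  obtain ⟨k, z, Q, hz, hQ, hX⟩ := hX
  refine ⟨k, fun j => t⁻¹ • z j, Q, fun j => (Set.mem_smul_set_iff_inv_smul_mem₀ ht _ _).1 (hz j),
    hQ, fun i => ?_⟩
  rw [Pi.smul_apply, hX, Finset.smul_sum]
  refine Finset.sum_congr rfl fun j _ => ?_
  ext a b
  simp [mul_assoc]

theorem mem_minMatrixConvexSet_of_forall_polytopeCompatible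
    {A : Fin g → Matrix (Fin d) (Fin d) ℂ} (hA : ∀ i, (A i).IsHermitian)
    (h0 : (0 : Fin g → ℝ) ∈ interior (convexHull ℝ (jointNumericalRange A)))
    (h : ∀ (k : ℕ) (P : Set (Fin g → ℝ)) (v : Fin k → Fin g → ℝ),
      IsPolytopeWithVertices P v → (0 : Fin g → ℝ) ∈ interior P →
      IsPolytopeOperators P A → IsPolytopeCompatible v A) :
    A ∈ minMatrixConvexSet (convexHull ℝ (jointNumericalRange A)) d := by
  have hd : d ≠ 0 := by
    rintro rfl
    -- For d = 0 there are no unit vectors, so the numerical range is empty.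
    obtain ⟨p, x, hx, -⟩ := convexHull_nonempty_iff.1 ⟨_, interior_subset h0⟩
    simp [Subsingleton.elim x 0] at hx
  have hW : jointNumericalRange A ⊆ convexHull ℝ (jointNumericalRange A) := subset_convexHull _ _
  set K := convexHull ℝ (jointNumericalRange A)
  have hKc : Convex ℝ K := convex_convexHull _ _
  have hK : IsCompact K := (isCompact_jointNumericalRange A hA).convexHull_of_finiteDimensional
  have hscale : ∀ t : ℝ, 1 < t → t⁻¹ • A ∈ minMatrixConvexSet K d := by
    intro t ht
    -- This is where 0 ∈ int K enters: dilating K about an interior point pushes it into the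
    -- interior of its dilate.
    have hint : K ⊆ interior (t • K) := by
      have hsub := hKc.subset_interior_image_homothety_of_one_lt h0 t ht
      have himage : AffineMap.homothety (0 : Fin g → ℝ) t '' K = t • K := by
        rw [← Set.image_smul]
        exact Set.image_congr fun x _ => by simp [AffineMap.homothety_apply]
      rwa [himage] at hsub
    obtain ⟨F, hF, hKF, hFK⟩ := exists_polytope_between hK (hKc.smul t) hint
    obtain ⟨k, v, hv⟩ := exists_isPolytopeWithVertices_convexHull hF
    have hcomp := h k _ v hv (interior_mono hKF h0)
      (isPolytopeOperators_of_jointNumericalRange_subset hA (hW.trans hKF))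
    refine inv_smul_mem_minMatrixConvexSet (by positivity)
      (hcomp.mem_minMatrixConvexSet fun j => hFK ?_)
    rw [hv.eq_convexHull]
    exact subset_convexHull _ _ (Set.mem_range_self j)
  have htend : Filter.Tendsto (fun t : ℝ => t⁻¹ • A) (nhdsWithin 1 (Set.Ioi 1)) (nhds A) := by
    have h1 : Filter.Tendsto (fun t : ℝ => t⁻¹ • A) (nhds 1) (nhds ((1 : ℝ)⁻¹ • A)) :=
      (tendsto_inv₀ one_ne_zero).smul_const A
    rw [inv_one, one_smul] at h1
    exact h1.mono_left nhdsWithin_le_nhds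
  exact (isClosed_minMatrixConvexSet hd hK).mem_of_tendsto htend
    (eventually_mem_nhdsWithin.mono fun t ht => hscale t ht)

theorem IsPolytopeWithVertices.isPolytopeCompatible {k : ℕ} {P : Set (Fin g → ℝ)}
    {v : Fin k → Fin g → ℝ} (hP : IsPolytopeWithVertices P v) (h0 : (0 : Fin g → ℝ) ∈ P)
    {A : Fin g → Matrix (Fin d) (Fin d) ℂ} (hAP : IsPolytopeOperators P A)
    (hA : A ∈ minMatrixConvexSet (convexHull ℝ (jointNumericalRange A)) d) :
    IsPolytopeCompatible v A := by
  have hPc : Convex ℝ P := hP.eq_convexHull ▸ convex_convexHull _ _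
  have hPcl : IsClosed P := by
    rw [hP.eq_convexHull]
    exact (Set.finite_range v).isClosed_convexHull ℝ
  refine IsPolytopeCompatible.of_mem_minMatrixConvexSet (minMatrixConvexSet_mono ?_ hA)
  rw [← hP.eq_convexHull]
  exact convexHull_min (hAP.jointNumericalRange_subset hPc hPcl h0) hPc

end Polytopes

theorem hasDeterminingCommutingPart_iff_mem_minMatrixConvexSet {g d : ℕ}
    {A : Fin g → Matrix (Fin d) (Fin d) ℂ} (hA : ∀ i, (A i).IsHermitian) :
    HasDeterminingCommutingPart A ↔
      A ∈ minMatrixConvexSet (convexHull ℝ (jointNumericalRange A)) d :=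
  ⟨fun h => h.mem_minMatrixConvexSet hA, fun h => .of_mem_minMatrixConvexSet hA h⟩

theorem mainTheorem2 (d g : ℕ) (A : Fin g → Matrix (Fin d) (Fin d) ℂ)
    (hA : ∀ i, (A i).IsHermitian) :
    ((0 : Fin g → ℝ) ∈ interior (convexHull ℝ (jointNumericalRange A)) →
      ((∀ (k : ℕ) (P : Set (Fin g → ℝ)) (v : Fin k → Fin g → ℝ),
          IsPolytopeWithVertices P v → (0 : Fin g → ℝ) ∈ interior P →
          IsPolytopeOperators P A → IsPolytopeCompatible v A) ↔
        HasDeterminingCommutingPart A)) ∧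
    ((∀ n : ℕ, matrixRange A n =
        minMatrixConvexSet (convexHull ℝ (jointNumericalRange A)) n) ↔
      HasDeterminingCommutingPart A) := by
  rw [hasDeterminingCommutingPart_iff_mem_minMatrixConvexSet hA]
  refine ⟨fun h0 => ⟨fun h => mem_minMatrixConvexSet_of_forall_polytopeCompatible hA h0 h,
    fun h k P v hP hP0 hAP => hP.isPolytopeCompatible (interior_subset hP0) hAP h⟩,
    fun h => h d ▸ mem_matrixRange_self A, fun h n => ?_⟩
  exact (matrixRange_subset_minMatrixConvexSet h n).antisymm
    (minMatrixConvexSet_subset_matrixRange A n)
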